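/- **Setting.** Let $N\in\mathbb N$, $T>0$, $u_0:\mathbb R^N\to\mathbb R$. Assume $c_0\in C([0,T);L^1(\mathbb R^N))$ with $\sup_{t}\|c_0(\cdot,t)\|_{L^1}<\infty$, $D_xc_0\in L^\infty([0,T);L^1(\mathbb R^N))$, and $c_1\in C(\mathbb R^N\times[0,T))$ bounded and Lipschitz continuous in $x$ uniformly in $t$. Write $c_0^+=\max(0,c_0)$, $c_0^-=\max(0,-c_0)$ and $(f(\cdot,t)\star g(\cdot,t))(x)=\int_{\mathbb R^N}f(x-y,t)\,g(y,t)\,dy$. **$L^1$-viscosity solutions.** Let $c:\mathbb R^N\times(0,T)\to\mathbb R$ be a velocity. An upper semicontinuous function $v$ on $\mathbb R^N\times[0,T)$ is an $L^1$-viscosity subsolution of $v_t=c\,|Dv|$ in $\mathbb R^N\times(0,T)$, $v(\cdot,0)=u_0$, if $v(\cdot,0)\le u_0$ and if, for all $(x_0,t_0)\in\mathbb R^N\times(0,T)$, $b\in L^1(0,T)$, $\varphi\in C^\infty(\mathbb R^N\times(0,T))$ and continuous $G:\mathbb R^N\times(0,T)\times\mathbb R^N\to\mathbb R$ such that (i)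 $(x,t)\mapsto v(x,t)-\int_0^tb(s)\,ds-\varphi(x,t)$ has a local maximum over $\mathbb R^N\times(0,T)$ at $(x_0,t_0)$, and (ii) for almost every $t\in(0,T)$ in some neighbourhood of $t_0$ and every $(x,p)$ in some neighbourhood of $(x_0,p_0)$, where $p_0=D\varphi(x_0,t_0)$ is the gradient in $x$, one has $c(x,t)|p|-b(t)\le G(x,t,p)$, one has $\partial_t\varphi(x_0,t_0)\le G(x_0,t_0,p_0)$. Supersolutions are lower semicontinuous and are defined in the same way with a local minimum and all inequalities ($v(\cdot,0)\ge u_0$, in (ii), and in the conclusion) reversed. A locally bounded $v$ on $\mathbb R^N\times[0,T)$ is an $L^1$-viscosity solution if its upper (lower) semicontinuous envelope is a subsolution (supersolution). **Weak solutions.** A function $u\in W^{1,\infty}(\mathbb R^N\times[0,T))$ (identified with its continuous representative) is a weak solution on $[0,T)$ of $$u_t=\big(c_0(\cdot,t)\star\mathbf 1_{\{u(\cdot,t)\ge0\}}+c_1\big)|Du|\ \text{ in }\mathbb R^N\times(0,T),\qquad u(\cdot,0)=u_0,$$ if there is a measurable $\chi:\mathbb R^N\times(0,T)\to[0,1]$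 with $\mathbf 1_{\{u>0\}}\le\chi\le\mathbf 1_{\{u\ge0\}}$ almost everywhere in $\mathbb R^N\times(0,T)$ such that $u$ is an $L^1$-viscosity solution of $u_t=\bar c\,|Du|$, $u(\cdot,0)=u_0$, where $\bar c(x,t)=(c_0(\cdot,t)\star\chi(\cdot,t))(x)+c_1(x,t)$. **Proposition 3.1.** Let $u$ be a weak solution. Then $u$ is an $L^1$-viscosity subsolution of $$u_t=\Big(c_0^+(\cdot,t)\star\mathbf 1_{\{u(\cdot,t)\ge0\}}(x)-c_0^-(\cdot,t)\star\mathbf 1_{\{u(\cdot,t)>0\}}(x)+c_1(x,t)\Big)|Du|,\qquad u(\cdot,0)=u_0,$$ and an $L^1$-viscosity supersolution of $$u_t=\Big(c_0^+(\cdot,t)\star\mathbf 1_{\{u(\cdot,t)>0\}}(x)-c_0^-(\cdot,t)\star\mathbf 1_{\{u(\cdot,t)\ge0\}}(x)+c_1(x,t)\Big)|Du|,\qquad u(\cdot,0)=u_0,$$ in $\mathbb R^N\times(0,T)$. -/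

import Mathlib

open MeasureTheory Set Filter Topology
open scoped ContDiff

/-- The space `ℝ^N` with its Euclidean norm. -/
abbrev RN (N : ℕ) : Type := EuclideanSpace ℝ (Fin N)

/-- The open space-time strip `ℝ^N × (0,T)`. -/
def openStrip (N : ℕ) (T : ℝ) : Set (RN N × ℝ) := univ ×ˢ Ioo 0 T

/-- The space-time strip `ℝ^N × [0,T)`. -/
def strip (N : ℕ) (T : ℝ) : Set (RN N × ℝ) := univ ×ˢ Ico 0 T

/-- `g` is the weak (distributional) derivative of `f` in the direction `e` on the open set `Ω`. -/
def HasWeakDirDeriv {F : Type*} [NormedAddCommGroup F] [NormedSpace ℝ F] [MeasureSpace F]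
    (Ω : Set F) (f g : F → ℝ) (e : F) : Prop :=
  ∀ φ : F → ℝ, ContDiff ℝ ∞ φ → HasCompactSupport φ → tsupport φ ⊆ Ω →
    ∫ z in Ω, f z * fderiv ℝ φ z e = -∫ z in Ω, g z * φ z

/-- `u ∈ W^{1,∞}(ℝ^N × [0,T))`: `u` and its weak first derivatives in space-time are essentially
bounded on `ℝ^N × (0,T)`; as usual `u` is its continuous representative, up to time `0`. -/
structure MemW1Infty {N : ℕ} (T : ℝ) (u : RN N × ℝ → ℝ) : Prop where
  continuousOn : ContinuousOn u (strip N T)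
  memLp : MemLp u ⊤ (volume.restrict (openStrip N T))
  weakDeriv : ∀ e : RN N × ℝ, ∃ g : RN N × ℝ → ℝ,
    MemLp g ⊤ (volume.restrict (openStrip N T)) ∧ HasWeakDirDeriv (openStrip N T) u g e

/-- The standing assumptions on the kernel `c₀` and on the driving term `c₁`:
`c₀ ∈ C([0,T); L¹(ℝ^N))` is bounded in `L¹`, `D_x c₀ ∈ L^∞([0,T); L¹(ℝ^N))`, and
`c₁ ∈ C(ℝ^N × [0,T))` is bounded and Lipschitz continuous in space, uniformly in time. -/
structure KernelAssumptions {N : ℕ} (T : ℝ) (c₀ c₁ : RN N × ℝ → ℝ) : Prop where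
  integrable : ∀ t ∈ Ico 0 T, Integrable (fun x => c₀ (x, t))
  continuous_L1 : ∀ t ∈ Ico 0 T,
    Tendsto (fun s => ∫ x, |c₀ (x, s) - c₀ (x, t)|) (𝓝[Ico 0 T] t) (𝓝 0)
  bound_L1 : ∃ M₀ : ℝ, ∀ t ∈ Ico 0 T, ∫ x, |c₀ (x, t)| ≤ M₀
  weakGrad : ∃ L₀ : ℝ, ∀ᵐ t, t ∈ Ico 0 T → ∃ g : RN N → RN N, Integrable g ∧
    (∀ e : RN N, HasWeakDirDeriv univ (fun x => c₀ (x, t)) (fun x => inner ℝ (g x) e) e) ∧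
    ∫ x, ‖g x‖ ≤ L₀
  continuousOn : ContinuousOn c₁ (strip N T)
  bound : ∃ M₁ : ℝ, ∀ x, ∀ t ∈ Ico 0 T, |c₁ (x, t)| ≤ M₁
  lipschitz : ∃ L₁ : ℝ, ∀ x y, ∀ t ∈ Ico 0 T, |c₁ (x, t) - c₁ (y, t)| ≤ L₁ * ‖x - y‖

/-- The convolution in space `(f(·,t) ⋆ g(·,t))(x) = ∫ f(x-y,t) g(y,t) dy`, at `z = (x,t)`. -/
noncomputable def spaceConv {N : ℕ} (f g : RN N × ℝ → ℝ) (z : RN N × ℝ) : ℝ :=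
  ∫ y, f (z.1 - y, z.2) * g (y, z.2)

/-- An upper semicontinuous `v` is an `L¹`-viscosity subsolution of
`v_t = c |Dv|` in `ℝ^N × (0,T)`, `v(·,0) = u₀`. -/
structure IsL1Subsolution {N : ℕ} (T : ℝ) (u₀ : RN N → ℝ) (c v : RN N × ℝ → ℝ) : Prop where
  usc : UpperSemicontinuousOn v (strip N T)
  initial : ∀ x, v (x, 0) ≤ u₀ x
  viscosity : ∀ (x₀ : RN N), ∀ t₀ ∈ Ioo 0 T, ∀ (b : ℝ → ℝ) (φ : RN N × ℝ → ℝ)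
    (G : RN N × ℝ × RN N → ℝ) (p₀ : RN N),
    IntegrableOn b (Ioo 0 T) → ContDiffOn ℝ ∞ φ (openStrip N T) →
    ContinuousOn G (univ ×ˢ Ioo 0 T ×ˢ univ) →
    p₀ = gradient (fun x => φ (x, t₀)) x₀ →
    IsLocalMaxOn (fun z : RN N × ℝ => v z - (∫ s in (0)..z.2, b s) - φ z)
      (openStrip N T) (x₀, t₀) →
    (∃ U ∈ 𝓝 t₀, ∃ V ∈ 𝓝 (x₀, p₀), ∀ᵐ t, t ∈ U ∩ Ioo 0 T → ∀ x p, (x, p) ∈ V →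
      c (x, t) * ‖p‖ - b t ≤ G (x, t, p)) →
    deriv (fun t => φ (x₀, t)) t₀ ≤ G (x₀, t₀, p₀)

/-- A lower semicontinuous `v` is an `L¹`-viscosity supersolution of
`v_t = c |Dv|` in `ℝ^N × (0,T)`, `v(·,0) = u₀`. -/
structure IsL1Supersolution {N : ℕ} (T : ℝ) (u₀ : RN N → ℝ) (c v : RN N × ℝ → ℝ) : Prop where
  lsc : LowerSemicontinuousOn v (strip N T)
  initial : ∀ x, u₀ x ≤ v (x, 0)
  viscosity : ∀ (x₀ : RN N), ∀ t₀ ∈ Ioo 0 T, ∀ (b : ℝ → ℝ) (φ : RN N × ℝ → ℝ)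
    (G : RN N × ℝ × RN N → ℝ) (p₀ : RN N),
    IntegrableOn b (Ioo 0 T) → ContDiffOn ℝ ∞ φ (openStrip N T) →
    ContinuousOn G (univ ×ˢ Ioo 0 T ×ˢ univ) →
    p₀ = gradient (fun x => φ (x, t₀)) x₀ →
    IsLocalMinOn (fun z : RN N × ℝ => v z - (∫ s in (0)..z.2, b s) - φ z)
      (openStrip N T) (x₀, t₀) →
    (∃ U ∈ 𝓝 t₀, ∃ V ∈ 𝓝 (x₀, p₀), ∀ᵐ t, t ∈ U ∩ Ioo 0 T → ∀ x p, (x, p) ∈ V →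
      G (x, t, p) ≤ c (x, t) * ‖p‖ - b t) →
    G (x₀, t₀, p₀) ≤ deriv (fun t => φ (x₀, t)) t₀

/-- The upper semicontinuous envelope of a locally bounded function on `ℝ^N × [0,T)`. -/
noncomputable def uscEnvelope {N : ℕ} (T : ℝ) (v : RN N × ℝ → ℝ) (z : RN N × ℝ) : ℝ :=
  limsup v (𝓝[strip N T] z)

/-- The lower semicontinuous envelope of a locally bounded function on `ℝ^N × [0,T)`. -/
noncomputable def lscEnvelope {N : ℕ} (T : ℝ) (v : RN N × ℝ → ℝ) (z : RN N × ℝ) : ℝ :=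
  liminf v (𝓝[strip N T] z)

/-- A locally bounded `v` is an `L¹`-viscosity solution if its upper (lower) semicontinuous
envelope is an `L¹`-viscosity subsolution (supersolution). -/
structure IsL1Solution {N : ℕ} (T : ℝ) (u₀ : RN N → ℝ) (c v : RN N × ℝ → ℝ) : Prop where
  locallyBounded : ∀ z ∈ strip N T, ∃ C : ℝ, ∀ᶠ w in 𝓝[strip N T] z, |v w| ≤ C
  sub : IsL1Subsolution T u₀ c (uscEnvelope T v)
  super : IsL1Supersolution T u₀ c (lscEnvelope T v)

/-- The indicator function of `{u ≥ 0}`. -/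
noncomputable def indNonneg {N : ℕ} (u : RN N × ℝ → ℝ) : RN N × ℝ → ℝ :=
  indicator {z | 0 ≤ u z} 1

/-- The indicator function of `{u > 0}`. -/
noncomputable def indPos {N : ℕ} (u : RN N × ℝ → ℝ) : RN N × ℝ → ℝ :=
  indicator {z | 0 < u z} 1

/-- `u` is a weak solution on `[0,T)` of the dislocation equation
`u_t = (c₀(·,t) ⋆ 1_{u(·,t) ≥ 0} + c₁) |Du|`, `u(·,0) = u₀`.
Lebesgue measurability of `χ` is expressed by `AEMeasurable`. -/
structure IsWeakSolution {N : ℕ} (T : ℝ) (c₀ c₁ : RN N × ℝ → ℝ) (u₀ : RN N → ℝ)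
    (u : RN N × ℝ → ℝ) : Prop where
  memW1Infty : MemW1Infty T u
  exists_chi : ∃ χ : RN N × ℝ → ℝ,
    AEMeasurable χ (volume.restrict (openStrip N T)) ∧
    (∀ z ∈ openStrip N T, χ z ∈ Icc (0 : ℝ) 1) ∧
    (∀ᵐ z, z ∈ openStrip N T → indPos u z ≤ χ z ∧ χ z ≤ indNonneg u z) ∧
    IsL1Solution T u₀ (fun z => spaceConv c₀ χ z + c₁ z) u

/-! Write `c₀ = c₀⁺ - c₀⁻`. Since `indPos u ≤ χ ≤ indNonneg u` almost everywhere, replacing `χ` by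
the larger indicator against `c₀⁺` and by the smaller one against `c₀⁻` bounds `c₀ ⋆ χ` from above;
the opposite choice bounds it from below. By Fubini this holds for almost every `t`, and then for
every `x` (`spaceConv_mem_Icc`). The viscosity notion sees the velocity only through condition (ii),
which is required for almost every `t`, so the comparison of velocities transfers directly
(`mono_velocity`). Continuity of `u` removes the semicontinuous envelopes. -/

/-- Enlarging the velocity at almost every time preserves `L¹`-viscosity subsolutions. -/
theorem IsL1Subsolution.mono_velocity {N : ℕ} {T : ℝ} {u₀ : RN N → ℝ} {c c' v : RN N × ℝ → ℝ}
    (h : IsL1Subsolution T u₀ c v) (hcc : ∀ᵐ t, t ∈ Ioo 0 T → ∀ x, c (x, t) ≤ c' (x, t)) :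
    IsL1Subsolution T u₀ c' v where
  usc := h.usc
  initial := h.initial
  viscosity := by
    rintro x₀ t₀ ht₀ b φ G p₀ hb hφ hG hp hmax ⟨U, hU, V, hV, hUV⟩
    refine h.viscosity x₀ t₀ ht₀ b φ G p₀ hb hφ hG hp hmax ⟨U, hU, V, hV, ?_⟩
    -- The velocity enters only here: a `G` admissible for `c'` is admissible for `c`, because `c *
    -- ‖p‖ ≤ c' * ‖p‖`.
    filter_upwards [hUV, hcc] with t h1 h2 ht x p hxp
    have := mul_le_mul_of_nonneg_right (h2 ht.2 x) (norm_nonneg p)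
    linarith [h1 ht x p hxp]

/-- Reducing the velocity at almost every time preserves `L¹`-viscosity supersolutions. -/
theorem IsL1Supersolution.mono_velocity {N : ℕ} {T : ℝ} {u₀ : RN N → ℝ} {c c' v : RN N × ℝ → ℝ}
    (h : IsL1Supersolution T u₀ c v) (hcc : ∀ᵐ t, t ∈ Ioo 0 T → ∀ x, c' (x, t) ≤ c (x, t)) :
    IsL1Supersolution T u₀ c' v where
  lsc := h.lsc
  initial := h.initial
  viscosity := by
    rintro x₀ t₀ ht₀ b φ G p₀ hb hφ hG hp hmin ⟨U, hU, V, hV, hUV⟩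
    refine h.viscosity x₀ t₀ ht₀ b φ G p₀ hb hφ hG hp hmin ⟨U, hU, V, hV, ?_⟩
    filter_upwards [hUV, hcc] with t h1 h2 ht x p hxp
    have := mul_le_mul_of_nonneg_right (h2 ht.2 x) (norm_nonneg p)
    linarith [h1 ht x p hxp]

theorem openStrip_subset_strip (N : ℕ) (T : ℝ) : openStrip N T ⊆ strip N T :=
  prod_mono le_rfl Ioo_subset_Ico_self

theorem uscEnvelope_eq {N : ℕ} {T : ℝ} {v : RN N × ℝ → ℝ} (hv : ContinuousOn v (strip N T))
    {z : RN N × ℝ} (hz : z ∈ strip N T) : uscEnvelope T v z = v z :=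
  have := mem_closure_iff_nhdsWithin_neBot.1 (subset_closure hz)
  (hv z hz).limsup_eq

theorem lscEnvelope_eq {N : ℕ} {T : ℝ} {v : RN N × ℝ → ℝ} (hv : ContinuousOn v (strip N T))
    {z : RN N × ℝ} (hz : z ∈ strip N T) : lscEnvelope T v z = v z :=
  have := mem_closure_iff_nhdsWithin_neBot.1 (subset_closure hz)
  (hv z hz).liminf_eq

/-- A continuous `L¹`-viscosity solution is a subsolution. -/
theorem IsL1Solution.isL1Subsolution {N : ℕ} {T : ℝ} {u₀ : RN N → ℝ} {c v : RN N × ℝ → ℝ}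
    (hT : 0 < T) (h : IsL1Solution T u₀ c v) (hv : ContinuousOn v (strip N T)) :
    IsL1Subsolution T u₀ c v where
  usc := hv.upperSemicontinuousOn
  initial x := by
    have := h.sub.initial x
    -- Time `0` lies in the strip because `0 < T`.
    rwa [uscEnvelope_eq hv ⟨mem_univ _, le_rfl, hT⟩] at this
  viscosity := by
    intro x₀ t₀ ht₀ b φ G p₀ hb hφ hG hp hmax hUV
    refine h.sub.viscosity x₀ t₀ ht₀ b φ G p₀ hb hφ hG hp ?_ hUV
    have hz : (x₀, t₀) ∈ openStrip N T := ⟨mem_univ _, ht₀⟩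
    filter_upwards [hmax, self_mem_nhdsWithin] with w hw hwS
    rwa [uscEnvelope_eq hv (openStrip_subset_strip N T hwS),
      uscEnvelope_eq hv (openStrip_subset_strip N T hz)]

/-- A continuous `L¹`-viscosity solution is a supersolution. -/
theorem IsL1Solution.isL1Supersolution {N : ℕ} {T : ℝ} {u₀ : RN N → ℝ} {c v : RN N × ℝ → ℝ}
    (hT : 0 < T) (h : IsL1Solution T u₀ c v) (hv : ContinuousOn v (strip N T)) :
    IsL1Supersolution T u₀ c v where
  lsc := hv.lowerSemicontinuousOn
  initial x := by
    have := h.super.initial x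
    rwa [lscEnvelope_eq hv ⟨mem_univ _, le_rfl, hT⟩] at this
  viscosity := by
    intro x₀ t₀ ht₀ b φ G p₀ hb hφ hG hp hmin hUV
    refine h.super.viscosity x₀ t₀ ht₀ b φ G p₀ hb hφ hG hp ?_ hUV
    have hz : (x₀, t₀) ∈ openStrip N T := ⟨mem_univ _, ht₀⟩
    filter_upwards [hmin, self_mem_nhdsWithin] with w hw hwS
    rwa [lscEnvelope_eq hv (openStrip_subset_strip N T hwS),
      lscEnvelope_eq hv (openStrip_subset_strip N T hz)]

/-- Upper bound for the integral of `f χ` when `α ≤ χ ≤ β` almost everywhere. -/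
theorem integral_mul_le_posPart_sub_negPart {X : Type*} [MeasurableSpace X] {μ : Measure X}
    {f χ α β : X → ℝ} (hf : Integrable f μ) (hχ : AEMeasurable χ μ) (hα : AEMeasurable α μ)
    (hβ : AEMeasurable β μ) (hα0 : ∀ y, 0 ≤ α y) (hβ1 : ∀ y, β y ≤ 1)
    (hαχ : ∀ᵐ y ∂μ, α y ≤ χ y) (hχβ : ∀ᵐ y ∂μ, χ y ≤ β y) :
    ∫ y, f y * χ y ∂μ ≤ (∫ y, max 0 (f y) * β y ∂μ) - ∫ y, max 0 (-f y) * α y ∂μ := by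
  have key : ∀ {g η : X → ℝ}, Integrable g μ → AEMeasurable η μ →
      (∀ᵐ y ∂μ, 0 ≤ η y ∧ η y ≤ 1) → Integrable (fun y => g y * η y) μ := by
    intro g η hg hη hb
    refine hg.mul_bdd (c := 1) hη.aestronglyMeasurable ?_
    filter_upwards [hb] with y hy
    rw [Real.norm_eq_abs, abs_of_nonneg hy.1]
    exact hy.2
  have hfp : Integrable (fun y => max 0 (f y)) μ := by simpa only [max_comm] using hf.pos_part
  have hfn : Integrable (fun y => max 0 (-f y)) μ := by simpa only [max_comm] using hf.neg_part
  have iβ : Integrable (fun y => max 0 (f y) * β y) μ := by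
    refine key hfp hβ ?_
    filter_upwards [hαχ, hχβ] with y h1 h2
    exact ⟨(hα0 y).trans (h1.trans h2), hβ1 y⟩
  have iα : Integrable (fun y => max 0 (-f y) * α y) μ := by
    refine key hfn hα ?_
    filter_upwards [hαχ, hχβ] with y h1 h2
    exact ⟨hα0 y, (h1.trans h2).trans (hβ1 y)⟩
  have iχ : Integrable (fun y => f y * χ y) μ := by
    refine key hf hχ ?_
    filter_upwards [hαχ, hχβ] with y h1 h2
    exact ⟨(hα0 y).trans h1, h2.trans (hβ1 y)⟩
  rw [← integral_sub iβ iα]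
  refine integral_mono_ae iχ (iβ.sub iα) ?_
  filter_upwards [hαχ, hχβ] with y h1 h2
  -- The upper bound on `χ` is used against the positive part of `f`, the lower bound against the
  -- negative part.
  have e : f y = max 0 (f y) - max 0 (-f y) := by
    rcases le_total 0 (f y) with h | h <;> simp [h]
  have p1 := mul_le_mul_of_nonneg_left h2 (le_max_left 0 (f y))
  have p2 := mul_le_mul_of_nonneg_left h1 (le_max_left 0 (-f y))
  calc f y * χ y = max 0 (f y) * χ y - max 0 (-f y) * χ y := by rw [← sub_mul, ← e]
    _ ≤ _ := by linarith

theorem volume_restrict_openStrip (N : ℕ) (T : ℝ) :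
    (volume.restrict (openStrip N T) : Measure (RN N × ℝ)) =
      (volume : Measure (RN N)).prod (volume.restrict (Ioo 0 T)) := by
  rw [openStrip, Measure.volume_eq_prod, ← Measure.prod_restrict, Measure.restrict_univ]

/-- Almost every time slice of a property holding almost everywhere in the open strip. -/
theorem ae_slice_of_ae_openStrip {N : ℕ} {T : ℝ} {P : RN N × ℝ → Prop}
    (h : ∀ᵐ z ∂volume.restrict (openStrip N T), P z) :
    ∀ᵐ t, t ∈ Ioo 0 T → ∀ᵐ x : RN N, P (x, t) := by
  rw [volume_restrict_openStrip] at h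
  rw [← ae_restrict_iff' measurableSet_Ioo]
  -- Swapping the factors makes time the outer variable of Fubini.
  exact Measure.ae_ae_of_ae_prod
    (Measure.measurePreserving_swap.quasiMeasurePreserving.ae h)

/-- Almost every time slice of a measurable function on the open strip is measurable. -/
theorem aemeasurable_slice_of_openStrip {N : ℕ} {T : ℝ} {χ : RN N × ℝ → ℝ}
    (h : AEMeasurable χ (volume.restrict (openStrip N T))) :
    ∀ᵐ t, t ∈ Ioo 0 T → AEMeasurable (fun x : RN N => χ (x, t)) := by
  filter_upwards [ae_slice_of_ae_openStrip h.ae_eq_mk] with t ht htT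
  exact ⟨fun x => h.mk χ (x, t), h.measurable_mk.comp measurable_prodMk_right, ht htT⟩

theorem continuous_slice {N : ℕ} {T t : ℝ} {u : RN N × ℝ → ℝ} (hu : ContinuousOn u (strip N T))
    (ht : t ∈ Ico 0 T) : Continuous fun x => u (x, t) :=
  hu.comp_continuous (by fun_prop) fun _ => ⟨mem_univ _, ht⟩

theorem measurable_indNonneg_slice {N : ℕ} {t : ℝ} {u : RN N × ℝ → ℝ}
    (hu : Continuous fun x => u (x, t)) : Measurable fun x => indNonneg u (x, t) :=
  (measurable_const (a := (1 : ℝ))).indicator (measurableSet_le measurable_const hu.measurable)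

theorem measurable_indPos_slice {N : ℕ} {t : ℝ} {u : RN N × ℝ → ℝ}
    (hu : Continuous fun x => u (x, t)) : Measurable fun x => indPos u (x, t) :=
  (measurable_const (a := (1 : ℝ))).indicator (measurableSet_lt measurable_const hu.measurable)

/-- For almost every time, `c₀ ⋆ χ` lies between the two extremal nonlocal velocities. -/
theorem spaceConv_mem_Icc {N : ℕ} {T : ℝ} {c₀ χ u : RN N × ℝ → ℝ}
    (hc : ∀ t ∈ Ico 0 T, Integrable (fun x => c₀ (x, t))) (hu : ContinuousOn u (strip N T))
    (hχ : AEMeasurable χ (volume.restrict (openStrip N T)))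
    (hχu : ∀ᵐ z, z ∈ openStrip N T → indPos u z ≤ χ z ∧ χ z ≤ indNonneg u z) :
    ∀ᵐ t, t ∈ Ioo 0 T → ∀ x, spaceConv c₀ χ (x, t) ∈ Icc
      (spaceConv (fun w => max 0 (c₀ w)) (indPos u) (x, t)
        - spaceConv (fun w => max 0 (-c₀ w)) (indNonneg u) (x, t))
      (spaceConv (fun w => max 0 (c₀ w)) (indNonneg u) (x, t)
        - spaceConv (fun w => max 0 (-c₀ w)) (indPos u) (x, t)) := by
  have hS : MeasurableSet (openStrip N T) := MeasurableSet.univ.prod measurableSet_Ioo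
  filter_upwards [aemeasurable_slice_of_openStrip hχ,
    ae_slice_of_ae_openStrip ((ae_restrict_iff' hS).2 hχu)] with t hm hle ht x
  have ht' := Ioo_subset_Ico_self ht
  have hut := continuous_slice hu ht'
  -- The exceptional null set in `y` depends on `t` alone and `x` only shifts the kernel, so the
  -- bounds hold at every `x`.
  have hf : Integrable fun y => c₀ (x - y, t) := (hc t ht').comp_sub_left x
  have h0 : ∀ y, 0 ≤ indPos u (y, t) := fun y =>
    indicator_nonneg (fun _ _ => zero_le_one) _
  have h1 : ∀ y, indNonneg u (y, t) ≤ 1 := fun y =>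
    indicator_le_self' (fun _ _ => zero_le_one) _
  have hP := (measurable_indPos_slice hut).aemeasurable (μ := volume)
  have hN := (measurable_indNonneg_slice hut).aemeasurable (μ := volume)
  have hl := (hle ht).mono fun _ h => h.1
  have hr := (hle ht).mono fun _ h => h.2
  constructor
  -- The lower bound is the upper bound for `-c₀`, whose positive and negative parts are exchanged.
  · have h := integral_mul_le_posPart_sub_negPart hf.neg (hm ht) hP hN h0 h1 hl hr
    simp only [Pi.neg_apply, neg_neg, neg_mul, integral_neg] at h
    simp only [spaceConv]
    linarith
  · exact integral_mul_le_posPart_sub_negPart hf (hm ht) hP hN h0 h1 hl hr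

theorem proposition3p1 (N : ℕ) (T : ℝ) (hT : 0 < T) (c₀ c₁ : RN N × ℝ → ℝ)
    (hc : KernelAssumptions T c₀ c₁) (u₀ : RN N → ℝ) (u : RN N × ℝ → ℝ)
    (hu : IsWeakSolution T c₀ c₁ u₀ u) :
    IsL1Subsolution T u₀
      (fun z => spaceConv (fun w => max 0 (c₀ w)) (indNonneg u) z
        - spaceConv (fun w => max 0 (-c₀ w)) (indPos u) z + c₁ z) u ∧
    IsL1Supersolution T u₀
      (fun z => spaceConv (fun w => max 0 (c₀ w)) (indPos u) z
        - spaceConv (fun w => max 0 (-c₀ w)) (indNonneg u) z + c₁ z) u := by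
  obtain ⟨χ, hχ, -, hχu, hsol⟩ := hu.exists_chi
  have hcont := hu.memW1Infty.continuousOn
  have hmem := spaceConv_mem_Icc hc.integrable hcont hχ hχu
  constructor
  · refine (hsol.isL1Subsolution hT hcont).mono_velocity ?_
    filter_upwards [hmem] with t h ht x
    exact add_le_add_left (h ht x).2 _
  · refine (hsol.isL1Supersolution hT hcont).mono_velocity ?_
    filter_upwards [hmem] with t h ht x
    exact add_le_add_left (h ht x).1 _
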